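/- Let $\mathbb D=\{z\in\mathbb C:|z|<1\}$ and $D(a,\rho)=\{z\in\mathbb C:|z-a|<\rho\}$. Let $R_O,R_I,R_C>0$ and let $\Omega\subset\mathbb C$ be a convex open set containing $0$ such that - the boundary of $\Omega$ is $C^{1,1}$-smooth, i.e. it is a simple closed curve whose unit speed parametrization has Lipschitz continuous derivative; - $R_O$ is the minimal $\rho$ such that $\Omega\subset D(0,\rho)$; - $R_I$ is the maximal $\rho$ such that $D(0,\rho)\subset\Omega$; - $\Omega$ is a union of open disks of radius $R_C$. Put $R=\max(R_C,R_I)$, $r=\min(R_C,R_I)$, $d=R_O-R_C$, $\theta=\arcsin\frac{R-r}{d}$ (used only when $r<R$), and define $$F(R_O,R_I,R_C)=\begin{cases}\dfrac dR & \text{if } r=R,\\[2mm] \dfrac12\log\dfrac{R+d}{R-d} & \text{if } r<R \text{ and } d\le R\tan\frac\theta2,\\[2mm] \dfrac12\left[\cot\frac\theta2\,\log\left(\frac Rr\cos\theta\right)+\log\dfrac{1+\tan(\theta/2)}{1-\tan(\theta/2)}\right] & \text{if } r<R \text{ and } d> R\tan\frac\theta2.\end{cases}$$ Then every conformal map (injective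 holomorphic function) $f$ from $\mathbb D$ onto $\Omega$ with $f(0)=0$ satisfies $$\|f'\|_{H^\infty}=\sup_{z\in\mathbb D}|f'(z)|\le R_C\,e^{2F(R_O,R_I,R_C)}.$$ -/

import Mathlib

noncomputable section

/-- The boundary of a bounded plane domain `Ω` is `C^{1,1}`-smooth: it is a simple closed curve whose
unit speed parametrization `γ` (periodic, with period the length `ℓ` of the curve) is differentiable
with Lipschitz continuous derivative. -/
def HasC11Boundary (Ω : Set ℂ) : Prop :=
  ∃ (ℓ : ℝ) (K : NNReal) (γ : ℝ → ℂ),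
    0 < ℓ ∧ Function.Periodic γ ℓ ∧ Set.InjOn γ (Set.Ico 0 ℓ) ∧ Set.range γ = frontier Ω ∧
      Differentiable ℝ γ ∧ (∀ t, ‖deriv γ t‖ = 1) ∧ LipschitzWith K (deriv γ)

/-- The `(R_O, R_I, R_C)` condition on a convex plane domain `Ω` containing `0` with `C^{1,1}`-smooth
boundary: `R_O` is the outer radius, `R_I` the inner radius and `R_C` a curvature radius.
(Simple connectedness of `Ω` is automatic, since `Ω` is convex and nonempty.) -/
structure RadiiCondition (Ω : Set ℂ) (R_O R_I R_C : ℝ) : Prop where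
  isOpen : IsOpen Ω
  convex : Convex ℝ Ω
  zero_mem : (0 : ℂ) ∈ Ω
  boundary : HasC11Boundary Ω
  outer_pos : 0 < R_O
  inner_pos : 0 < R_I
  curvature_pos : 0 < R_C
  outer : IsLeast {r : ℝ | Ω ⊆ Metric.ball (0 : ℂ) r} R_O
  inner : IsGreatest {r : ℝ | Metric.ball (0 : ℂ) r ⊆ Ω} R_I
  union_disks : ∃ A : Set ℂ, Ω = ⋃ a ∈ A, Metric.ball a R_C

/-- The explicit function `F(R_O, R_I, R_C)`. -/
def radiiF (R_O R_I R_C : ℝ) : ℝ :=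
  let R : ℝ := max R_C R_I
  let r : ℝ := min R_C R_I
  let d : ℝ := R_O - R_C
  let θ : ℝ := Real.arcsin ((R - r) / d)
  if r = R then d / R
  else if d ≤ R * Real.tan (θ / 2) then 1 / 2 * Real.log ((R + d) / (R - d))
  else 1 / 2 * (Real.cot (θ / 2) * Real.log (R / r * Real.cos θ)
    + Real.log ((1 + Real.tan (θ / 2)) / (1 - Real.tan (θ / 2))))

/-- `f` is a conformal map (injective and holomorphic) of the open unit disk onto `Ω`. -/
structure IsConformalFromDiskOnto (f : ℂ → ℂ) (Ω : Set ℂ) : Prop where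
  holomorphic : DifferentiableOn ℂ f (Metric.ball 0 1)
  injOn : Set.InjOn f (Metric.ball 0 1)
  image_eq : f '' Metric.ball 0 1 = Ω

/-- The `H^∞` norm of a function on the open unit disk, as an extended nonnegative real
(it equals `∞` exactly when the function is unbounded on the disk). -/
def hInftyNorm (g : ℂ → ℂ) : ENNReal :=
  ⨆ z ∈ Metric.ball (0 : ℂ) 1, ‖g z‖ₑ

end

open Set Filter Topology Metric ComplexConjugate

/-! Measure hyperbolic distance with density `1 / (1 - |z|²)`, so that `z` lies at distance `artanh
‖z‖` from `0`, and transport it to `Ω` by `g = f⁻¹`. By Schwarz–Pick, distances in `Ω` are at most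
those in any disk inside `Ω`.

Centres of disks of radius `R_C` inside `Ω` lie within `F` of `0`
(`RadiiCondition.artanh_norm_le_radiiF`): the hull of such a disk and `D(0, R_I)` is in `Ω`, and one
integrates along the segment of centres, comparing at each point with a disk inscribed in the hull.
The best inscribed disks produce the three cases of `F`.

Let `w = f z` be at distance `δ` from the complement. If `artanh ‖z‖ > F`, then `δ < R_C`, and the
`R_C`-disk touching the boundary at a point nearest to `w` has its centre within `R_C - δ` of `w`
(`exists_ball_subset_norm_sub_le`). With `s = ‖z‖` this gives `(1 + s) / (1 - s) ≤ e^{2F} (2 R_C -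
δ) / δ`. Convexity gives `(1 - s²) |f' z| ≤ 2 δ` (`norm_deriv_mul_le_of_convex`). In the product `δ`
cancels, so `|f' z| ≤ 4 R_C e^{2F} / (1 + s)²`. The maximum principle and `s → 1` finish. -/

/-! ### Holomorphic inverses -/

/-- The inverse of an injective holomorphic function is holomorphic. -/
theorem exists_holomorphic_inverse {f : ℂ → ℂ} {U : Set ℂ} (hU : IsOpen U)
    (hf : DifferentiableOn ℂ f U) (hinj : InjOn f U) :
    ∃ g : ℂ → ℂ, DifferentiableOn ℂ g (f '' U) ∧ (∀ z ∈ U, g (f z) = z) := by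
  have hg : ∀ z ∈ U, Function.invFunOn f U (f z) = z := fun z hz => hinj.leftInvOn_invFunOn hz
  set g := Function.invFunOn f U
  have han : ∀ z ∈ U, AnalyticAt ℂ f z := fun z hz => hf.analyticAt (hU.mem_nhds hz)
  have hne : ∀ z ∈ U, ¬ ∀ᶠ w in 𝓝 z, f w = f z := by
    intro z hz h
    have h1 : ∀ᶠ w in 𝓝[≠] z, w ∈ U ∧ f w = f z :=
      ((hU.eventually_mem hz).and h).filter_mono nhdsWithin_le_nhds
    obtain ⟨w, ⟨hwU, hw⟩, hwz⟩ := (h1.and eventually_mem_nhdsWithin).exists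
    exact hwz (hinj hwU hz hw)
  -- Open mapping theorem: a property of points near `f z` may be checked on values `f x` with `x`
  -- near `z`.
  have hle : ∀ z ∈ U, 𝓝 (f z) ≤ map f (𝓝 z) := fun z hz =>
    (han z hz).eventually_constant_or_nhds_le_map_nhds.resolve_left (hne z hz)
  have hcont : ∀ z ∈ U, ContinuousAt g (f z) := by
    intro z hz
    have h1 : Tendsto g (map f (𝓝 z)) (𝓝 z) := by
      rw [tendsto_map'_iff]
      refine tendsto_id.congr' ?_
      filter_upwards [hU.eventually_mem hz] with w hw using (hg w hw).symm
    have := h1.mono_left (hle z hz)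
    rwa [ContinuousAt, hg z hz]
  have hright : ∀ z ∈ U, ∀ᶠ w in 𝓝 (f z), f (g w) = w := by
    intro z hz
    refine Eventually.filter_mono (hle z hz) ?_
    rw [eventually_map]
    filter_upwards [hU.eventually_mem hz] with w hw
    rw [hg w hw]
  have hreg : ∀ z ∈ U, deriv f z ≠ 0 → DifferentiableAt ℂ g (f z) := by
    intro z hz hd
    refine (HasDerivAt.of_local_left_inverse (f := f) (f' := deriv f z) (hcont z hz) ?_ hd
      (hright z hz)).differentiableAt
    rw [hg z hz]
    exact (han z hz).differentiableAt.hasDerivAt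
  refine ⟨g, ?_, hg⟩
  rintro _ ⟨z, hz, rfl⟩
  -- Critical points of `f` are isolated, and `g` is continuous, so any exceptional points are
  -- removable; `deriv f z ≠ 0` need not be proved.
  refine (Complex.analyticAt_of_differentiable_on_punctured_nhds_of_continuousAt ?_
    (hcont z hz)).differentiableAt.differentiableWithinAt
  have hd : ∀ᶠ w in 𝓝[≠] z, deriv f w ≠ 0 := by
    refine (han z hz).deriv.eventually_eq_zero_or_eventually_ne_zero.resolve_left fun h0 => ?_
    obtain ⟨ε, hε, hb⟩ := Metric.eventually_nhds_iff_ball.1 (h0.and (hU.eventually_mem hz))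
    refine hne z hz (Metric.eventually_nhds_iff_ball.2 ⟨ε, hε, fun w hw => ?_⟩)
    exact isOpen_ball.is_const_of_deriv_eq_zero (convex_ball z ε).isPreconnected
      (fun x hx => (hf x (hb x hx).2).mono fun y hy => (hb y hy).2)
      (fun x hx => (hb x hx).1) hw (mem_ball_self hε)
  have hd' : ∀ᶠ w in 𝓝 z, w ≠ z → deriv f w ≠ 0 := eventually_nhdsWithin_iff.1 hd
  have hd'' : ∀ᶠ w in map f (𝓝 z), w ≠ f z → DifferentiableAt ℂ g w := by
    rw [eventually_map]
    filter_upwards [hd', hU.eventually_mem hz] with w hw hwU hne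
    exact hreg w hwU (hw fun h => hne (h ▸ rfl))
  exact eventually_nhdsWithin_iff.2 (hd''.filter_mono (hle z hz))

/-! ### Möbius maps and Schwarz–Pick estimates -/

theorem normSq_one_sub_conj_mul_sub (b w : ℂ) :
    ‖1 - conj b * w‖ ^ 2 - ‖w - b‖ ^ 2 = (1 - ‖b‖ ^ 2) * (1 - ‖w‖ ^ 2) := by
  simp only [← Complex.normSq_eq_norm_sq, Complex.normSq_apply]
  simp
  ring

theorem one_sub_conj_mul_ne_zero {b w : ℂ} (hb : ‖b‖ < 1) (hw : ‖w‖ < 1) :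
    1 - conj b * w ≠ 0 := by
  intro h
  have : ‖conj b * w‖ = 1 := by rw [← sub_eq_zero.1 h, norm_one]
  rw [norm_mul, Complex.norm_conj] at this
  nlinarith [norm_nonneg b, norm_nonneg w]

theorem norm_mobius_lt_one {b w : ℂ} (hb : ‖b‖ < 1) (hw : ‖w‖ < 1) :
    ‖(w - b) / (1 - conj b * w)‖ < 1 := by
  have h0 := norm_pos_iff.2 (one_sub_conj_mul_ne_zero hb hw)
  rw [norm_div, div_lt_one h0]
  have := normSq_one_sub_conj_mul_sub b w
  have h1 : 0 < (1 - ‖b‖ ^ 2) * (1 - ‖w‖ ^ 2) := by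
    apply mul_pos <;> nlinarith [norm_nonneg b, norm_nonneg w]
  exact lt_of_pow_lt_pow_left₀ 2 h0.le (by linarith)

theorem hasDerivAt_mobius {b w : ℂ} (h : 1 - conj b * w ≠ 0) :
    HasDerivAt (fun w => (w - b) / (1 - conj b * w))
      ((1 - conj b * b) / (1 - conj b * w) ^ 2) w := by
  have h1 : HasDerivAt (fun w : ℂ => w - b) 1 w := (hasDerivAt_id w).sub_const b
  have h2 : HasDerivAt (fun w : ℂ => 1 - conj b * w) (-(conj b * 1)) w :=
    ((hasDerivAt_id w).const_mul (conj b)).const_sub 1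
  refine (h1.div h2 h).congr_deriv ?_
  congr 1
  ring

theorem norm_one_sub_conj_mul_self {b : ℂ} (hb : ‖b‖ < 1) : ‖1 - conj b * b‖ = 1 - ‖b‖ ^ 2 := by
  rw [Complex.conj_mul', ← Complex.ofReal_pow, ← Complex.ofReal_one, ← Complex.ofReal_sub,
    Complex.norm_real, Real.norm_of_nonneg]
  nlinarith [norm_nonneg b]

/-- The **Schwarz–Pick lemma**, infinitesimal form. -/
theorem schwarz_pick {f : ℂ → ℂ} (hf : DifferentiableOn ℂ f (ball 0 1))
    (hm : MapsTo f (ball 0 1) (ball 0 1)) {z : ℂ} (hz : z ∈ ball (0 : ℂ) 1) :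
    ‖deriv f z‖ * (1 - ‖z‖ ^ 2) ≤ 1 - ‖f z‖ ^ 2 := by
  have hz1 : ‖z‖ < 1 := by simpa using hz
  have hb1 : ‖f z‖ < 1 := by simpa using hm hz
  set b := f z with hb
  -- `φ` sends `0` to `z` and `m` sends `f z` to `0`, so the Schwarz lemma applies to `m ∘ f ∘ φ`.
  let φ : ℂ → ℂ := fun w => (w - (-z)) / (1 - conj (-z) * w)
  let m : ℂ → ℂ := fun w => (w - b) / (1 - conj b * w)
  have hφ0 : φ 0 = z := by simp [φ]
  have hnz : ‖-z‖ < 1 := by simpa using hz1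
  have hφm : ∀ w ∈ ball (0 : ℂ) 1, φ w ∈ ball (0 : ℂ) 1 := fun w hw => by
    rw [mem_ball_zero_iff] at hw ⊢
    exact norm_mobius_lt_one hnz hw
  have hmm : ∀ w ∈ ball (0 : ℂ) 1, m w ∈ ball (0 : ℂ) 1 := fun w hw => by
    rw [mem_ball_zero_iff] at hw ⊢
    exact norm_mobius_lt_one hb1 hw
  have hφd : ∀ w ∈ ball (0 : ℂ) 1, HasDerivAt φ _ w := fun w hw =>
    hasDerivAt_mobius (one_sub_conj_mul_ne_zero hnz (by simpa using hw))
  have hmd : ∀ w ∈ ball (0 : ℂ) 1, HasDerivAt m _ w := fun w hw =>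
    hasDerivAt_mobius (one_sub_conj_mul_ne_zero hb1 (by simpa using hw))
  have hfd : ∀ w ∈ ball (0 : ℂ) 1, HasDerivAt f (deriv f w) w := fun w hw =>
    (hf.differentiableAt (isOpen_ball.mem_nhds hw)).hasDerivAt
  have hcomp : ∀ w ∈ ball (0 : ℂ) 1, HasDerivAt (m ∘ f ∘ φ) _ w := fun w hw =>
    (hmd _ (hm (hφm w hw))).comp w ((hfd _ (hφm w hw)).comp w (hφd w hw))
  have h0 : (0 : ℂ) ∈ ball (0 : ℂ) 1 := mem_ball_self one_pos
  have key := Complex.norm_deriv_le_one_of_mapsTo_ball (f := m ∘ f ∘ φ) (c := 0) (R := 1)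
    (fun w hw => (hcomp w hw).differentiableAt.differentiableWithinAt)
    (fun w hw => by
      have : (m ∘ f ∘ φ) 0 = 0 := by simp [m, hφ0, hb]
      rw [this]
      exact ball_subset_closedBall (hmm _ (hm (hφm w hw)))) one_pos
  rw [(hcomp 0 h0).deriv] at key
  have e1 : f (φ 0) = b := by rw [hφ0]
  simp only [hφ0, mul_zero, sub_zero, one_pow, div_one, norm_mul,
    norm_div, norm_pow] at key
  rw [norm_one_sub_conj_mul_self hb1, norm_one_sub_conj_mul_self hnz, norm_neg] at key
  have hpos : 0 < 1 - ‖b‖ ^ 2 := by nlinarith [norm_nonneg b]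
  have e2 : (1 - ‖b‖ ^ 2) / (1 - ‖b‖ ^ 2) ^ 2 = (1 - ‖b‖ ^ 2)⁻¹ := by field_simp
  rw [e2, inv_mul_le_iff₀ hpos, mul_one] at key
  exact key

/-- The Schwarz–Pick lemma for maps from a disk of arbitrary centre and radius. -/
theorem schwarz_pick_ball {g : ℂ → ℂ} {a : ℂ} {ρ : ℝ} (hρ : 0 < ρ)
    (hg : DifferentiableOn ℂ g (ball a ρ)) (hm : MapsTo g (ball a ρ) (ball 0 1)) {w : ℂ}
    (hw : w ∈ ball a ρ) :
    ‖deriv g w‖ ≤ ρ / (ρ ^ 2 - ‖w - a‖ ^ 2) * (1 - ‖g w‖ ^ 2) := by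
  have hρc : (ρ : ℂ) ≠ 0 := by exact_mod_cast hρ.ne'
  let ψ : ℂ → ℂ := fun ζ => a + ρ * ζ
  have hψ : ∀ ζ, HasDerivAt ψ ρ ζ := fun ζ =>
    (((hasDerivAt_id ζ).const_mul (ρ : ℂ)).const_add a).congr_deriv (mul_one _)
  have hψm : ∀ ζ ∈ ball (0 : ℂ) 1, ψ ζ ∈ ball a ρ := fun ζ hζ => by
    rw [mem_ball_zero_iff] at hζ
    rw [mem_ball_iff_norm]
    simp only [ψ, add_sub_cancel_left, norm_mul, Complex.norm_real, Real.norm_of_nonneg hρ.le]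
    nlinarith
  have hwn : ‖w - a‖ < ρ := by rwa [mem_ball_iff_norm] at hw
  set ζ : ℂ := (w - a) / ρ with hζ
  have hnζ : ‖ζ‖ = ‖w - a‖ / ρ := by
    rw [hζ, norm_div, Complex.norm_real, Real.norm_of_nonneg hρ.le]
  have hζ1 : ζ ∈ ball (0 : ℂ) 1 := by
    rw [mem_ball_zero_iff, hnζ, div_lt_one hρ]
    exact hwn
  have hψζ : ψ ζ = w := by
    simp only [ψ, hζ]
    field_simp
    ring
  have hd : ∀ x ∈ ball (0 : ℂ) 1, HasDerivAt (g ∘ ψ) (deriv g (ψ x) * ρ) x := fun x hx =>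
    HasDerivAt.comp x ((hg.differentiableAt (isOpen_ball.mem_nhds (hψm x hx))).hasDerivAt) (hψ x)
  have key := schwarz_pick (f := g ∘ ψ)
    (fun x hx => (hd x hx).differentiableAt.differentiableWithinAt)
    (fun x hx => hm (hψm x hx)) hζ1
  rw [(hd ζ hζ1).deriv, Function.comp_apply, hψζ, norm_mul, Complex.norm_real,
    Real.norm_of_nonneg hρ.le, hnζ] at key
  have hpos : 0 < ρ ^ 2 - ‖w - a‖ ^ 2 := by nlinarith [norm_nonneg (w - a)]
  rw [div_mul_eq_mul_div, le_div_iff₀ hpos]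
  have e : ‖deriv g w‖ * ρ * (1 - (‖w - a‖ / ρ) ^ 2) = ‖deriv g w‖ * (ρ ^ 2 - ‖w - a‖ ^ 2) / ρ := by
    field_simp
  rw [e, div_le_iff₀ hρ] at key
  linarith

/-- A holomorphic function from the unit disk to the half-plane `re < c` satisfies the
Schwarz–Pick bound with the distance to the boundary line. -/
theorem norm_deriv_mul_le_of_re_lt {f : ℂ → ℂ} (hf : DifferentiableOn ℂ f (ball 0 1)) {c : ℝ}
    (hre : ∀ z ∈ ball (0 : ℂ) 1, (f z).re < c) {z : ℂ} (hz : z ∈ ball (0 : ℂ) 1) :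
    ‖deriv f z‖ * (1 - ‖z‖ ^ 2) ≤ 2 * (c - (f z).re) := by
  -- `v` is the reflection of `f z` in the line `re = c`; hence `k` below is `f` followed by the map
  -- of the half-plane to the disk that sends `f z` to `0`.
  set v : ℂ := 2 * c - conj (f z) with hv
  have hden : ∀ w ∈ ball (0 : ℂ) 1, f w - v ≠ 0 := fun w hw h => by
    have := congrArg Complex.re h
    simp [hv] at this
    linarith [hre w hw, hre z hz]
  let k : ℂ → ℂ := fun w => (f w - f z) / (f w - v)
  have hkd : ∀ w ∈ ball (0 : ℂ) 1, HasDerivAt k _ w := fun w hw => by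
    have h := (hf.differentiableAt (isOpen_ball.mem_nhds hw)).hasDerivAt
    exact (h.sub_const (f z)).div (h.sub_const v) (hden w hw)
  have hkm : MapsTo k (ball 0 1) (ball 0 1) := fun w hw => by
    have h0 := norm_pos_iff.2 (hden w hw)
    rw [mem_ball_zero_iff, norm_div, div_lt_one h0]
    refine lt_of_pow_lt_pow_left₀ 2 h0.le ?_
    simp only [← Complex.normSq_eq_norm_sq, Complex.normSq_apply]
    simp [hv]
    nlinarith [hre w hw, hre z hz]
  have key := schwarz_pick (fun x hx => (hkd x hx).differentiableAt.differentiableWithinAt) hkm hz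
  rw [(hkd z hz).deriv] at key
  have hzv : f z - v = ((-(2 * (c - (f z).re)) : ℝ) : ℂ) := by
    apply Complex.ext <;> simp [hv]
    ring
  have hpos : 0 < 2 * (c - (f z).re) := by linarith [hre z hz]
  have hk0 : k z = 0 := by simp [k]
  rw [hk0, sub_self, zero_mul, sub_zero, norm_div, norm_mul, norm_pow, hzv, Complex.norm_real,
    norm_neg, Real.norm_of_nonneg hpos.le, norm_zero] at key
  rw [pow_two (2 * _), mul_div_mul_right _ _ hpos.ne', div_mul_eq_mul_div, div_le_iff₀ hpos] at key
  linarith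

/-! ### Hyperbolic length of paths -/

theorem Real.hasDerivAt_tanh' (x : ℝ) : HasDerivAt Real.tanh (1 - Real.tanh x ^ 2) x := by
  have hc := (Real.cosh_pos x).ne'
  have h := (Real.hasDerivAt_sinh x).div (Real.hasDerivAt_cosh x) hc
  have e : Real.tanh = fun x => Real.sinh x / Real.cosh x :=
    funext Real.tanh_eq_sinh_div_cosh
  rw [e]
  refine h.congr_deriv ?_
  field_simp

/-- Along a path in the unit disk, the hyperbolic distance to the origin grows at most by the
integral of a bound for the hyperbolic speed. -/
theorem artanh_norm_le_of_hasDerivAt {h h' : ℝ → ℂ} {P P' : ℝ → ℝ} {a b : ℝ} (hab : a ≤ b)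
    (hd : ∀ t ∈ Icc a b, HasDerivAt h (h' t) t) (hP : ∀ t ∈ Icc a b, HasDerivAt P (P' t) t)
    (h1 : ∀ t ∈ Icc a b, ‖h t‖ < 1)
    (hb : ∀ t ∈ Icc a b, ‖h' t‖ ≤ P' t * (1 - ‖h t‖ ^ 2)) :
    Real.artanh ‖h b‖ ≤ Real.artanh ‖h a‖ + (P b - P a) := by
  have hmem : ∀ t ∈ Icc a b, ‖h t‖ ∈ Ioo (-1 : ℝ) 1 := fun t ht =>
    ⟨by linarith [norm_nonneg (h t)], h1 t ht⟩
  have ha := left_mem_Icc.2 hab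
  have hbb := right_mem_Icc.2 hab
  -- `tanh ∘ Q` solves the extremal equation `y' = (1 - y²)(P' + ε)`; the extra `ε` supplies the
  -- strict inequality required by the comparison theorem.
  have key : ∀ ε > 0, Real.artanh ‖h b‖ ≤ Real.artanh ‖h a‖ + (P b - P a) + ε * (b - a) := by
    intro ε hε
    let Q : ℝ → ℝ := fun t => Real.artanh ‖h a‖ + (P t - P a) + ε * (t - a)
    have hQ : ∀ t ∈ Icc a b, HasDerivAt Q (P' t + ε) t := fun t ht => by
      refine ((((hP t ht).sub_const (P a)).const_add (Real.artanh ‖h a‖)).add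
        (((hasDerivAt_id t).sub_const a).const_mul ε)).congr_deriv ?_
      rw [mul_one]
    have hB : ∀ t ∈ Icc a b, HasDerivAt (fun t => Real.tanh (Q t))
        ((1 - Real.tanh (Q t) ^ 2) * (P' t + ε)) t := fun t ht =>
      (Real.hasDerivAt_tanh' (Q t)).comp t (hQ t ht)
    have := image_norm_le_of_norm_deriv_right_lt_deriv_boundary' (f := h) (f' := h')
      (a := a) (b := b)
      (fun t ht => (hd t ht).continuousAt.continuousWithinAt)
      (fun t ht => (hd t (Ico_subset_Icc_self ht)).hasDerivWithinAt)
      (B := fun t => Real.tanh (Q t))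
      (B' := fun t => (1 - Real.tanh (Q t) ^ 2) * (P' t + ε))
      (by simp [Q, Real.tanh_artanh (hmem a ha)])
      (fun t ht => (hB t ht).continuousAt.continuousWithinAt)
      (fun t ht => (hB t (Ico_subset_Icc_self ht)).hasDerivWithinAt)
      (fun t ht heq => by
        have ht' := Ico_subset_Icc_self ht
        have hpos : 0 < 1 - ‖h t‖ ^ 2 := by nlinarith [norm_nonneg (h t), h1 t ht']
        have := hb t ht'
        rw [← heq]
        nlinarith [mul_pos hpos hε]) hbb
    rw [← Real.tanh_artanh (hmem b hbb)] at this
    have hlt := Real.artanh_le_artanh (Real.neg_one_lt_tanh _) (Real.tanh_lt_one _) this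
    rwa [Real.artanh_tanh, Real.artanh_tanh] at hlt
  rcases hab.eq_or_lt with rfl | hlt
  · simp
  · refine le_of_forall_pos_le_add fun δ hδ => ?_
    have := key (δ / (b - a)) (div_pos hδ (sub_pos.2 hlt))
    rwa [div_mul_cancel₀ _ (sub_pos.2 hlt).ne'] at this

/-- The second inequality comes from traversing the path backwards, as `t ↦ h (-t)` on `[-b, -a]`.
-/
theorem abs_artanh_norm_sub_le_of_hasDerivAt {h h' : ℝ → ℂ} {P P' : ℝ → ℝ} {a b : ℝ} (hab : a ≤ b)
    (hd : ∀ t ∈ Icc a b, HasDerivAt h (h' t) t) (hP : ∀ t ∈ Icc a b, HasDerivAt P (P' t) t)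
    (h1 : ∀ t ∈ Icc a b, ‖h t‖ < 1)
    (hb : ∀ t ∈ Icc a b, ‖h' t‖ ≤ P' t * (1 - ‖h t‖ ^ 2)) :
    |Real.artanh ‖h b‖ - Real.artanh ‖h a‖| ≤ P b - P a := by
  have hneg : ∀ t ∈ Icc (-b) (-a), -t ∈ Icc a b := fun t ht =>
    ⟨by linarith [ht.2], by linarith [ht.1]⟩
  have h2 := artanh_norm_le_of_hasDerivAt (h := fun t => h (-t)) (h' := fun t => -h' (-t))
    (P := fun t => -P (-t)) (P' := fun t => P' (-t)) (neg_le_neg hab)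
    (fun t ht =>
      ((hd _ (hneg t ht)).scomp t (hasDerivAt_neg t)).congr_deriv (neg_one_smul ℝ _))
    (fun t ht =>
      ((hP _ (hneg t ht)).comp t (hasDerivAt_neg t)).neg.congr_deriv (by ring))
    (fun t ht => h1 _ (hneg t ht)) (fun t ht => by simpa using hb _ (hneg t ht))
  have h3 := artanh_norm_le_of_hasDerivAt hab hd hP h1 hb
  simp only [neg_neg] at h2
  rw [abs_le]
  constructor <;> linarith

/-! ### Distance between the centres of two disks in a convex domain -/

/-- The point with relative position `e` in the intermediate disk is the convex combination of `A +
R e` and `B + r e`. -/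
theorem ball_subset_of_convex_combination {Ω : Set ℂ} (hΩ : Convex ℝ Ω) {A B : ℂ} {R r s : ℝ}
    (hR : 0 < R) (hr : 0 < r) (hA : ball A R ⊆ Ω) (hB : ball B r ⊆ Ω) (hs : s ∈ Icc (0 : ℝ) 1) :
    ball (A + s * (B - A)) (R - s * (R - r)) ⊆ Ω := by
  intro x hx
  have hρ : 0 < R - s * (R - r) := by
    rcases hs with ⟨h0, h1⟩
    rcases h0.eq_or_lt with rfl | h0
    · simpa using hR
    · nlinarith [mul_pos h0 hr, mul_nonneg (sub_nonneg.2 h1) hR.le]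
  rw [mem_ball_iff_norm] at hx
  set e : ℂ := (x - (A + s * (B - A))) / ((R - s * (R - r) : ℝ) : ℂ) with he
  have hρc : ((R - s * (R - r) : ℝ) : ℂ) ≠ 0 := by exact_mod_cast hρ.ne'
  have he1 : ‖e‖ < 1 := by
    rw [he, norm_div, Complex.norm_real, Real.norm_of_nonneg hρ.le, div_lt_one hρ]
    exact hx
  have hxA : A + R * e ∈ Ω := hA (by
    rw [mem_ball_iff_norm, add_sub_cancel_left, norm_mul, Complex.norm_real,
      Real.norm_of_nonneg hR.le]
    nlinarith)
  have hxB : B + r * e ∈ Ω := hB (by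
    rw [mem_ball_iff_norm, add_sub_cancel_left, norm_mul, Complex.norm_real,
      Real.norm_of_nonneg hr.le]
    nlinarith)
  have hc := hΩ hxA hxB (sub_nonneg.2 hs.2) hs.1 (by ring)
  convert hc using 1
  have hx' : x = A + s * (B - A) + ((R - s * (R - r) : ℝ) : ℂ) * e := by
    rw [he, mul_div_cancel₀ _ hρc]
    ring
  rw [hx']
  simp only [Complex.real_smul]
  push_cast
  ring

/-- Speed estimate on the segment from `A` to `B`, parametrized by `[0, d]`, through the disk
inscribed in the hull of the two disks which is centred at parameter `y`. -/
theorem exists_hasDerivAt_segment {Ω : Set ℂ} (hc : Convex ℝ Ω) {g : ℂ → ℂ}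
    (hg : DifferentiableOn ℂ g Ω) (hm : MapsTo g Ω (ball 0 1)) {A B : ℂ} {R r d : ℝ}
    (hR : 0 < R) (hr : 0 < r) (hd : 0 < d) (hA : ball A R ⊆ Ω) (hB : ball B r ⊆ Ω)
    (hAB : ‖B - A‖ ≤ d) {t y : ℝ} (hy : y ∈ Icc 0 d) (hty : |t - y| < R - y / d * (R - r)) :
    HasDerivAt (fun t : ℝ => g (A + ((t / d : ℝ) : ℂ) * (B - A)))
      (deriv g (A + ((t / d : ℝ) : ℂ) * (B - A)) * ((B - A) / d)) t ∧
    ‖g (A + ((t / d : ℝ) : ℂ) * (B - A))‖ < 1 ∧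
    ‖deriv g (A + ((t / d : ℝ) : ℂ) * (B - A)) * ((B - A) / d)‖ ≤
      (R - y / d * (R - r)) / ((R - y / d * (R - r)) ^ 2 - (t - y) ^ 2) *
        (1 - ‖g (A + ((t / d : ℝ) : ℂ) * (B - A))‖ ^ 2) := by
  set ρ := R - y / d * (R - r) with hρ
  set w : ℂ := A + ((t / d : ℝ) : ℂ) * (B - A) with hw
  set a : ℂ := A + ((y / d : ℝ) : ℂ) * (B - A) with ha
  have hsub : ball a ρ ⊆ Ω := ball_subset_of_convex_combination hc hR hr hA hB
    ⟨div_nonneg hy.1 hd.le, (div_le_one hd).2 hy.2⟩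
  have hρ0 : 0 < ρ := (abs_nonneg _).trans_lt hty
  have hdc : (d : ℂ) ≠ 0 := by exact_mod_cast hd.ne'
  -- `d` only bounds `‖B - A‖` from above, so the path has speed at most one, which suffices for
  -- upper bounds.
  have hnd : ‖(B - A) / (d : ℂ)‖ ≤ 1 := by
    rw [norm_div, Complex.norm_real, Real.norm_of_nonneg hd.le, div_le_one hd]
    exact hAB
  have hwa : ‖w - a‖ ≤ |t - y| := by
    have : w - a = ((t - y : ℝ) : ℂ) * ((B - A) / d) := by
      rw [hw, ha]
      push_cast
      field_simp
      ring
    rw [this, norm_mul, Complex.norm_real, Real.norm_eq_abs]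
    exact mul_le_of_le_one_right (abs_nonneg _) hnd
  have hwb : w ∈ ball a ρ := by
    rw [mem_ball_iff_norm]
    exact hwa.trans_lt hty
  have hgw : ‖g w‖ < 1 := by simpa using hm (hsub hwb)
  have hpath : HasDerivAt (fun t : ℝ => A + ((t / d : ℝ) : ℂ) * (B - A)) ((B - A) / d) t := by
    have h1 : HasDerivAt (fun t : ℝ => ((t / d : ℝ) : ℂ)) ((1 / d : ℝ) : ℂ) t :=
      ((hasDerivAt_id t).div_const d).ofReal_comp
    refine ((h1.mul_const (B - A)).const_add A).congr_deriv ?_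
    push_cast
    ring
  have hgd : HasDerivAt g (deriv g w) w :=
    ((hg.mono hsub).differentiableAt (isOpen_ball.mem_nhds hwb)).hasDerivAt
  refine ⟨hgd.comp t hpath, hgw, ?_⟩
  have h1 := schwarz_pick_ball hρ0 (hg.mono hsub) (hm.mono_left hsub) hwb
  have h2 : ‖w - a‖ ^ 2 ≤ (t - y) ^ 2 := by
    rw [← sq_abs (t - y)]
    exact pow_le_pow_left₀ (norm_nonneg _) hwa 2
  have h3 : (t - y) ^ 2 < ρ ^ 2 := by
    rw [← sq_abs (t - y)]
    exact pow_lt_pow_left₀ hty (abs_nonneg _) two_ne_zero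
  have h4 : 0 ≤ 1 - ‖g w‖ ^ 2 := by nlinarith [norm_nonneg (g w)]
  rw [norm_mul]
  refine (mul_le_of_le_one_right (norm_nonneg _) hnd).trans (h1.trans ?_)
  have h5 : 0 < ρ ^ 2 - (t - y) ^ 2 := by linarith
  gcongr

/-- Two equal disks: the hyperbolic length of the segment between the centres. -/
theorem abs_artanh_sub_le_div {Ω : Set ℂ} (hc : Convex ℝ Ω) {g : ℂ → ℂ}
    (hg : DifferentiableOn ℂ g Ω) (hm : MapsTo g Ω (ball 0 1)) {A B : ℂ} {R d : ℝ}
    (hR : 0 < R) (hd : 0 < d) (hA : ball A R ⊆ Ω) (hB : ball B R ⊆ Ω) (hAB : ‖B - A‖ ≤ d) :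
    |Real.artanh ‖g B‖ - Real.artanh ‖g A‖| ≤ d / R := by
  have H := fun t (ht : t ∈ Icc 0 d) =>
    exists_hasDerivAt_segment hc hg hm hR hR hd hA hB hAB (t := t) (y := t) ht (by simpa using hR)
  have key := abs_artanh_norm_sub_le_of_hasDerivAt (P := fun t => t / R) (P' := fun _ => 1 / R)
    hd.le (fun t ht => (H t ht).1) (fun t _ => (hasDerivAt_id t).div_const R)
    (fun t ht => (H t ht).2.1) (fun t ht => by
      have e : (R - t / d * (R - R)) / ((R - t / d * (R - R)) ^ 2 - (t - t) ^ 2) = 1 / R := by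
        rw [sub_self, sub_self, mul_zero, sub_zero]
        field_simp
        ring
      exact e ▸ (H t ht).2.2)
  simpa [hd.ne'] using key

/-- The hyperbolic distance from the centre of a disk contained in the domain. -/
theorem abs_artanh_sub_le_log {Ω : Set ℂ} {g : ℂ → ℂ}
    (hg : DifferentiableOn ℂ g Ω) (hm : MapsTo g Ω (ball 0 1)) {A B : ℂ} {R d : ℝ}
    (hd : 0 ≤ d) (hdR : d < R) (hA : ball A R ⊆ Ω) (hAB : ‖B - A‖ ≤ d) :
    |Real.artanh ‖g B‖ - Real.artanh ‖g A‖| ≤ 1 / 2 * Real.log ((R + d) / (R - d)) := by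
  rcases hd.eq_or_lt with rfl | hd
  · rw [norm_le_zero_iff, sub_eq_zero] at hAB
    simp [hAB, (show R ≠ 0 from hdR.ne')]
  have hR : 0 < R := hd.trans hdR
  have hBA : B ∈ ball A R := by
    rw [mem_ball_iff_norm]
    exact hAB.trans_lt hdR
  -- This small disk only serves to apply the segment estimate; with `y = 0` its radius drops out.
  obtain ⟨r, hr, hB⟩ := Metric.isOpen_iff.1 isOpen_ball B hBA
  have H := fun t (ht : t ∈ Icc 0 d) =>
    exists_hasDerivAt_segment (convex_ball A R) (hg.mono hA) (hm.mono_left hA) hR hr hd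
      Subset.rfl hB hAB (t := t) (y := 0) ⟨le_rfl, hd.le⟩
      (by simpa [abs_of_nonneg ht.1] using ht.2.trans_lt hdR)
  have hP : ∀ t ∈ Icc 0 d, HasDerivAt (fun t => 1 / 2 * (Real.log (R + t) - Real.log (R - t)))
      (R / (R ^ 2 - t ^ 2)) t := fun t ht => by
    have h1 : R + t ≠ 0 := by linarith [ht.1]
    have h2 : R - t ≠ 0 := by linarith [ht.2]
    have h3 : R ^ 2 - t ^ 2 ≠ 0 := by
      rw [sq_sub_sq]
      exact mul_ne_zero h1 h2
    refine (((((hasDerivAt_id t).const_add R).log h1).sub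
      (((hasDerivAt_id t).const_sub R).log h2)).const_mul (1 / 2 : ℝ)).congr_deriv ?_
    simp only [id]
    field_simp
    ring
  have key := abs_artanh_norm_sub_le_of_hasDerivAt hd.le (fun t ht => (H t ht).1) hP
    (fun t ht => (H t ht).2.1) (fun t ht => by simpa using (H t ht).2.2)
  rw [Real.log_div (by linarith) (by linarith)]
  simpa [hd.ne'] using key

/-- The hyperbolic length of a piece of the axis of a cone. -/
theorem abs_artanh_sub_le_cone {Ω : Set ℂ} (hc : Convex ℝ Ω) {g : ℂ → ℂ}
    (hg : DifferentiableOn ℂ g Ω) (hm : MapsTo g Ω (ball 0 1)) {A B : ℂ} {R r d S C t₀ : ℝ}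
    (hR : 0 < R) (hr : 0 < r) (hd : 0 < d) (hA : ball A R ⊆ Ω) (hB : ball B r ⊆ Ω)
    (hAB : ‖B - A‖ ≤ d) (hS : 0 < S) (hC : 0 < C) (hSC : S ^ 2 + C ^ 2 = 1)
    (hSd : S * d = R - r) (ht₀ : t₀ = R / S * (1 - C)) (htd : t₀ ≤ d) :
    |Real.artanh ‖g B‖ - Real.artanh ‖g (A + ((t₀ / d : ℝ) : ℂ) * (B - A))‖| ≤
      S / (2 * (1 - C)) * (Real.log (R / S - t₀) - Real.log (R / S - d)) := by
  -- `X` is the parameter of the apex of the cone tangent to both disks: the inscribed radius at `y`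
  -- is `(X - y) S`.
  set X := R / S with hX
  have hXS : X * S = R := div_mul_cancel₀ _ hS.ne'
  have hC1 : C < 1 := by nlinarith
  have hdX : d < X := by
    rw [hX, lt_div_iff₀ hS]
    linarith
  have hX0 : 0 < X := hd.trans hdX
  have ht0 : 0 ≤ t₀ := by
    rw [ht₀]
    exact mul_nonneg hX0.le (by linarith)
  -- `y = X - (X - t) / C` minimizes the density bound at `t` over all inscribed disks. It is
  -- nonnegative exactly for `t ≥ t₀ = X (1 - C)`, where the optimal centre leaves `A`.
  have hy : ∀ t ∈ Icc t₀ d, X - (X - t) / C ∈ Icc 0 d := fun t ht => by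
    have h1 : (X - t) / C ≤ X := by
      rw [div_le_iff₀ hC]
      linarith [ht.1]
    have h2 : X - t ≤ (X - t) / C := by
      rw [le_div_iff₀ hC]
      nlinarith [ht.2]
    exact ⟨by linarith, by linarith [ht.2]⟩
  have hρ : ∀ y, R - y / d * (R - r) = (X - y) * S := fun y => by
    rw [← hSd, sub_mul, hXS]
    field_simp
  have hden : 0 < S ^ 2 - (1 - C) ^ 2 := by nlinarith
  have hS1 : 1 - C < S := lt_of_pow_lt_pow_left₀ 2 hS.le (by linarith)
  have H := fun t (ht : t ∈ Icc t₀ d) =>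
    exists_hasDerivAt_segment hc hg hm hR hr hd hA hB hAB (t := t) (hy t ht) (by
      have hp : 0 < (X - t) / C := div_pos (by linarith [ht.2]) hC
      have e : t - (X - (X - t) / C) = (X - t) / C * (1 - C) := by
        field_simp
        ring
      rw [hρ, e, abs_of_nonneg (mul_nonneg hp.le (by linarith))]
      nlinarith)
  have hP : ∀ t ∈ Icc t₀ d, HasDerivAt (fun t => -(S / (2 * (1 - C)) * Real.log (X - t)))
      (S / (2 * (1 - C)) / (X - t)) t := fun t ht => by
    have h2 : X - t ≠ 0 := by linarith [ht.2]
    refine ((((hasDerivAt_id t).const_sub X).log h2).const_mul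
      (S / (2 * (1 - C)))).neg.congr_deriv ?_
    simp only [id]
    ring
  have key := abs_artanh_norm_sub_le_of_hasDerivAt htd (fun t ht => (H t ht).1) hP
    (fun t ht => (H t ht).2.1) (fun t ht => by
      have h := (H t ht).2.2
      have h2 : X - t ≠ 0 := by linarith [ht.2]
      have h1C : 1 - C ≠ 0 := by linarith
      have e : (R - (X - (X - t) / C) / d * (R - r)) /
          ((R - (X - (X - t) / C) / d * (R - r)) ^ 2 - (t - (X - (X - t) / C)) ^ 2) =
          S / (2 * (1 - C)) / (X - t) := by
        rw [hρ]
        have e1 : (X - (X - (X - t) / C)) * S = (X - t) / C * S := by ring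
        have e2 : t - (X - (X - t) / C) = (X - t) / C * (1 - C) := by
          field_simp
          ring
        have e3 : S ^ 2 - (1 - C) ^ 2 = 2 * C * (1 - C) := by linear_combination hSC
        have e4 : ((X - t) / C * S) ^ 2 - ((X - t) / C * (1 - C)) ^ 2 =
            ((X - t) / C) ^ 2 * (2 * C * (1 - C)) := by
          rw [← e3]
          ring
        rw [e1, e2, e4]
        field_simp
      exact e ▸ h)
  have hB' : A + ((d / d : ℝ) : ℂ) * (B - A) = B := by
    rw [div_self hd.ne']
    push_cast
    ring
  rw [hB'] at key
  linarith

/-- The hyperbolic distance between the centres of a disk of radius `R` and a disk of radius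
`r < R` in the case of a long segment. -/
theorem abs_artanh_sub_le_disk_cone {Ω : Set ℂ} (hc : Convex ℝ Ω) {g : ℂ → ℂ}
    (hg : DifferentiableOn ℂ g Ω) (hm : MapsTo g Ω (ball 0 1)) {A B : ℂ} {R r d θ : ℝ}
    (hr : 0 < r) (hrR : r < R) (hA : ball A R ⊆ Ω) (hB : ball B r ⊆ Ω)
    (hAB : ‖B - A‖ ≤ d) (hθ : 0 < θ) (hθ' : θ < Real.pi / 2) (hsin : Real.sin θ * d = R - r)
    (hd : R * Real.tan (θ / 2) < d) :
    |Real.artanh ‖g B‖ - Real.artanh ‖g A‖| ≤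
      1 / 2 * (Real.cot (θ / 2) * Real.log (R / r * Real.cos θ)
        + Real.log ((1 + Real.tan (θ / 2)) / (1 - Real.tan (θ / 2)))) := by
  have hR : 0 < R := hr.trans hrR
  have hT : 0 < Real.tan (θ / 2) := Real.tan_pos_of_pos_of_lt_pi_div_two (by linarith) (by linarith)
  have hT1 : Real.tan (θ / 2) < 1 := by
    rw [← Real.tan_pi_div_four]
    exact Real.tan_lt_tan_of_lt_of_lt_pi_div_two (by linarith) (by linarith) (by linarith)
  have hC : 0 < Real.cos θ := Real.cos_pos_of_mem_Ioo ⟨by linarith, hθ'⟩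
  have hS : 0 < Real.sin θ := Real.sin_pos_of_pos_of_lt_pi hθ (by linarith)
  have hSC := Real.sin_sq_add_cos_sq θ
  have hsinT := Real.sin_eq_two_mul_tan_half_div_one_add_tan_half_sq θ
  have hcosT : Real.cos θ = (1 - Real.tan (θ / 2) ^ 2) / (1 + Real.tan (θ / 2) ^ 2) := by
    have h2 : 0 < Real.cos (θ / 2) := Real.cos_pos_of_mem_Ioo ⟨by linarith, by linarith⟩
    have h3 := Real.cos_two_mul (θ / 2)
    rw [mul_div_cancel₀ _ two_ne_zero] at h3
    have h4 := Real.sin_sq_add_cos_sq (θ / 2)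
    rw [h3, Real.tan_eq_sin_div_cos]
    field_simp
    rw [add_comm (Real.cos _ ^ 2), h4]
    linear_combination h4
  have hcot : Real.cot (θ / 2) = 1 / Real.tan (θ / 2) := by
    rw [Real.cot_eq_cos_div_sin, Real.tan_eq_sin_div_cos, one_div_div]
  set T := Real.tan (θ / 2)
  set S := Real.sin θ
  set C := Real.cos θ
  have h1C : 1 - C = S * T := by
    rw [hcosT, hsinT]
    field_simp
    ring
  have hd0 : 0 < d := (mul_pos hR hT).trans hd
  -- The path is split at `R tan(θ/2)`: before it the disk about `A` is used, after it the cone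
  -- estimate.
  have ht₀ : R * T = R / S * (1 - C) := by
    rw [h1C]
    field_simp
  have hcone := abs_artanh_sub_le_cone hc hg hm hR hr hd0 hA hB hAB hS hC hSC hsin ht₀ hd.le
  set M := A + ((R * T / d : ℝ) : ℂ) * (B - A) with hM
  have hMA : ‖M - A‖ ≤ R * T := by
    rw [hM, add_sub_cancel_left, norm_mul, Complex.norm_real,
      Real.norm_of_nonneg (div_nonneg (mul_pos hR hT).le hd0.le), div_mul_eq_mul_div,
      div_le_iff₀ hd0]
    exact mul_le_mul_of_nonneg_left hAB (mul_pos hR hT).le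
  have hdisk := abs_artanh_sub_le_log hg hm (mul_pos hR hT).le
    (mul_lt_of_lt_one_right hR hT1) hA hMA
  have e1 : (R + R * T) / (R - R * T) = (1 + T) / (1 - T) := by
    rw [show R + R * T = R * (1 + T) by ring, show R - R * T = R * (1 - T) by ring,
      mul_div_mul_left _ _ hR.ne']
  have e2 : R / S - R * T = R / S * C := by
    rw [ht₀]
    ring
  have e3 : R / S - d = r / S := by
    field_simp
    linarith
  have e4 : S / (2 * (1 - C)) = 1 / 2 * Real.cot (θ / 2) := by
    rw [h1C, hcot]
    field_simp
  rw [e1] at hdisk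
  rw [e2, e3, e4, ← Real.log_div (by positivity) (by positivity),
    show R / S * C / (r / S) = R / r * C by field_simp] at hcone
  have := abs_sub_le (Real.artanh ‖g B‖) (Real.artanh ‖g M‖) (Real.artanh ‖g A‖)
  linarith

/-- The hyperbolic distance between the centres of two disks contained in a convex domain. -/
theorem abs_artanh_sub_le_of_balls {Ω : Set ℂ} (hc : Convex ℝ Ω) {g : ℂ → ℂ}
    (hg : DifferentiableOn ℂ g Ω) (hm : MapsTo g Ω (ball 0 1)) {A B : ℂ} {R r d : ℝ}
    (hr : 0 < r) (hrR : r ≤ R) (hA : ball A R ⊆ Ω) (hB : ball B r ⊆ Ω) (hAB : ‖B - A‖ ≤ d) :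
    |Real.artanh ‖g B‖ - Real.artanh ‖g A‖| ≤
      if r = R then d / R
      else if d ≤ R * Real.tan (Real.arcsin ((R - r) / d) / 2) then
        1 / 2 * Real.log ((R + d) / (R - d))
      else 1 / 2 * (Real.cot (Real.arcsin ((R - r) / d) / 2) *
          Real.log (R / r * Real.cos (Real.arcsin ((R - r) / d)))
        + Real.log ((1 + Real.tan (Real.arcsin ((R - r) / d) / 2)) /
          (1 - Real.tan (Real.arcsin ((R - r) / d) / 2)))) := by
  have hR : 0 < R := hr.trans_le hrR
  have hd : 0 ≤ d := (norm_nonneg _).trans hAB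
  -- For `d = 0`, division by zero makes the angle `0`, and the bound is `0` whichever branch
  -- applies.
  rcases hd.eq_or_lt with rfl | hd
  · rw [norm_le_zero_iff, sub_eq_zero] at hAB
    simp [hAB, hR.ne']
  set θ := Real.arcsin ((R - r) / d) with hθ
  split_ifs with h1 h2
  · subst h1
    exact abs_artanh_sub_le_div hc hg hm hr hd hA hB hAB
  · have hrR' := lt_of_le_of_ne hrR h1
    refine abs_artanh_sub_le_log hg hm hd.le ?_ hA hAB
    -- If the quotient is at least `1`, `arcsin` is constantly `π / 2`, but then `d ≤ R - r < R`
    -- directly.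
    rcases lt_or_ge ((R - r) / d) 1 with h | h
    · have hθ1 : θ < Real.pi / 2 := Real.arcsin_lt_pi_div_two.2 h
      have hθ0 : 0 ≤ θ := Real.arcsin_nonneg.2 (div_nonneg (by linarith) hd.le)
      have : Real.tan (θ / 2) < 1 := by
        rw [← Real.tan_pi_div_four]
        exact Real.tan_lt_tan_of_lt_of_lt_pi_div_two (by linarith) (by linarith) (by linarith)
      nlinarith
    · rw [one_le_div hd] at h
      linarith
  · have hrR' := lt_of_le_of_ne hrR h1
    push Not at h2
    have h0 : 0 < (R - r) / d := div_pos (by linarith) hd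
    have hlt : (R - r) / d < 1 := by
      by_contra! h
      have hpi : θ / 2 = Real.pi / 4 := by
        rw [hθ, Real.arcsin_of_one_le h]
        ring
      rw [hpi, Real.tan_pi_div_four, mul_one] at h2
      rw [one_le_div hd] at h
      linarith
    refine abs_artanh_sub_le_disk_cone hc hg hm hr hrR' hA hB hAB (Real.arcsin_pos.2 h0)
      (Real.arcsin_lt_pi_div_two.2 hlt) ?_ h2
    rw [hθ, Real.sin_arcsin (by linarith) hlt.le, div_mul_cancel₀ _ hd.ne']

/-! ### Supporting lines and tangent disks -/

/-- An open convex plane set lies in an open half-plane whose boundary passes through a given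
point of its complement. -/
theorem exists_unit_normal {Ω : Set ℂ} (ho : IsOpen Ω) (hc : Convex ℝ Ω) (hne : Ω.Nonempty) {p : ℂ}
    (hp : p ∉ Ω) : ∃ n : ℂ, ‖n‖ = 1 ∧ ∀ x ∈ Ω, (conj n * x).re < (conj n * p).re := by
  obtain ⟨φ, hφ⟩ := geometric_hahn_banach_open_point hc ho hp
  set v : ℂ := ⟨φ 1, φ Complex.I⟩ with hv
  have hφv : ∀ x : ℂ, φ x = (conj v * x).re := fun x => by
    have hx : x = x.re • (1 : ℂ) + x.im • Complex.I := by simp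
    conv_lhs => rw [hx]
    rw [map_add, map_smul, map_smul]
    simp [hv]
    ring
  obtain ⟨x₀, hx₀⟩ := hne
  have hv0 : v ≠ 0 := fun h => by
    have := hφ x₀ hx₀
    simp [hφv, h] at this
  have hn : 0 < ‖v‖ := norm_pos_iff.2 hv0
  have e : ∀ x : ℂ, (conj (v / ‖v‖) * x).re = (conj v * x).re / ‖v‖ := fun x => by
    rw [map_div₀, Complex.conj_ofReal, div_mul_eq_mul_div, Complex.div_ofReal_re]
  refine ⟨v / ‖v‖, by rw [norm_div, Complex.norm_real, norm_norm, div_self hn.ne'], fun x hx => ?_⟩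
  rw [e, e]
  have := hφ x hx
  rw [hφv, hφv] at this
  gcongr

/-- A disk inside an open half-plane whose closure meets the boundary line at `p` has its centre
on the normal at `p`. -/
theorem center_eq_of_ball_subset_halfPlane {n p a : ℂ} {ρ : ℝ} (hn : ‖n‖ = 1) (hρ : 0 < ρ)
    (hb : ∀ x ∈ ball a ρ, (conj n * x).re < (conj n * p).re) (hpa : ‖p - a‖ ≤ ρ) :
    a = p - ρ * n := by
  have hcl : ∀ x ∈ closedBall a ρ, (conj n * x).re ≤ (conj n * p).re := by
    rw [← closure_ball a hρ.ne']
    have hclosed : IsClosed {x : ℂ | (conj n * x).re ≤ (conj n * p).re} :=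
      isClosed_le (by fun_prop) continuous_const
    exact closure_minimal (fun x hx => (hb x hx).le) hclosed
  have h1 := hcl (a + ρ * n) (by
    rw [mem_closedBall_iff_norm, add_sub_cancel_left, norm_mul, hn, Complex.norm_real,
      Real.norm_of_nonneg hρ.le, mul_one])
  have hn2 : n.re ^ 2 + n.im ^ 2 = 1 := by
    have := Complex.normSq_eq_norm_sq n
    rw [hn, Complex.normSq_apply] at this
    linarith
  have h2 : (p.re - a.re) ^ 2 + (p.im - a.im) ^ 2 ≤ ρ ^ 2 := by
    have := Complex.normSq_eq_norm_sq (p - a)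
    rw [Complex.normSq_apply] at this
    simp only [Complex.sub_re, Complex.sub_im] at this
    nlinarith [norm_nonneg (p - a)]
  simp at h1
  have h3 : ρ ≤ n.re * (p.re - a.re) + n.im * (p.im - a.im) := by nlinarith
  -- Equality case of Cauchy–Schwarz: `|p - a - ρ n|² = |p - a|² - 2 ρ ⟨n, p - a⟩ + ρ² ≤ ρ² - 2 ρ² +
  -- ρ²`.
  have h4 : (p.re - a.re - ρ * n.re) ^ 2 + (p.im - a.im - ρ * n.im) ^ 2 ≤ 0 := by nlinarith
  have h5 : p.re - a.re - ρ * n.re = 0 := by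
    nlinarith [sq_nonneg (p.re - a.re - ρ * n.re), sq_nonneg (p.im - a.im - ρ * n.im)]
  have h6 : p.im - a.im - ρ * n.im = 0 := by
    nlinarith [sq_nonneg (p.re - a.re - ρ * n.re), sq_nonneg (p.im - a.im - ρ * n.im)]
  apply Complex.ext <;> simp <;> linarith

/-- In a union of disks of radius `ρ`, every point of the closure lies in a closed disk of
radius `ρ` whose interior is contained in the union. -/
theorem exists_ball_subset_of_mem_closure {Ω : Set ℂ} {ρ : ℝ} {A : Set ℂ}
    (hA : Ω = ⋃ a ∈ A, ball a ρ) {p : ℂ} (hp : p ∈ closure Ω) :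
    ∃ a, ball a ρ ⊆ Ω ∧ ‖p - a‖ ≤ ρ := by
  set K : Set ℂ := {a | ball a ρ ⊆ Ω} with hK
  have hKc : IsClosed K := by
    have : K = ⋂ y ∈ Ωᶜ, {a | ρ ≤ dist y a} := by
      ext a
      simp only [hK, mem_ofPred_eq, mem_iInter, mem_compl_iff]
      constructor
      · intro h y hy
        by_contra! hlt
        exact hy (h hlt)
      · intro h y hy
        by_contra hy'
        exact absurd (h y hy') (not_le.2 hy)
    rw [this]
    exact isClosed_biInter fun y _ => isClosed_le continuous_const (by fun_prop)
  -- The admissible centres form a closed set `K`, and adding a compact disk keeps it closed, so the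
  -- sum contains `closure Ω`.
  have hsum : IsClosed (Set.image2 (· + ·) K (closedBall (0 : ℂ) ρ)) :=
    hKc.add_right_of_isCompact (isCompact_closedBall 0 ρ)
  have hsub : Ω ⊆ Set.image2 (· + ·) K (closedBall (0 : ℂ) ρ) := fun x hx => by
    rw [hA] at hx
    obtain ⟨a, ha, hxa⟩ := mem_iUnion₂.1 hx
    refine ⟨a, ?_, x - a, ?_, by simp⟩
    · rw [hK, mem_ofPred_eq, hA]
      exact subset_biUnion_of_mem (u := fun a => ball a ρ) ha
    · rw [mem_closedBall_zero_iff]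
      exact (mem_ball_iff_norm.1 hxa).le
  obtain ⟨a, ha, b, hb, rfl⟩ := closure_minimal hsub hsum hp
  exact ⟨a, ha, by simpa using hb⟩

/-- Near the boundary of a convex union of disks of radius `ρ`, a point at distance `δ ≤ ρ` from
the complement lies within `ρ - δ` of the centre of such a disk. -/
theorem exists_ball_subset_norm_sub_le {Ω : Set ℂ} (ho : IsOpen Ω) (hc : Convex ℝ Ω) {ρ δ : ℝ}
    (hρ : 0 < ρ) {A : Set ℂ} (hA : Ω = ⋃ a ∈ A, ball a ρ) {w p : ℂ} (hδ : 0 < δ) (hδρ : δ ≤ ρ)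
    (hw : ball w δ ⊆ Ω) (hp : p ∉ Ω) (hpw : ‖p - w‖ = δ) :
    ∃ a, ball a ρ ⊆ Ω ∧ ‖w - a‖ ≤ ρ - δ := by
  have hcl : p ∈ closure Ω := by
    refine closure_mono hw ?_
    rw [closure_ball w hδ.ne', mem_closedBall_iff_norm]
    exact hpw.le
  obtain ⟨a, ha, hpa⟩ := exists_ball_subset_of_mem_closure hA hcl
  obtain ⟨n, hn, hlt⟩ := exists_unit_normal ho hc ⟨w, hw (mem_ball_self hδ)⟩ hp
  -- Both disks touch the same supporting line at `p`, so both centres lie on the normal there, at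
  -- distances `ρ` and `δ` from `p`.
  have h1 := center_eq_of_ball_subset_halfPlane hn hρ (fun x hx => hlt x (ha hx)) hpa
  have h2 := center_eq_of_ball_subset_halfPlane hn hδ (fun x hx => hlt x (hw hx)) hpw.le
  refine ⟨a, ha, ?_⟩
  have h3 : w - a = ((ρ - δ : ℝ) : ℂ) * n := by
    rw [h1, h2]
    push_cast
    ring
  rw [h3, norm_mul, hn, Complex.norm_real, Real.norm_of_nonneg (by linarith), mul_one]

/-- For a holomorphic map from the unit disk into a convex domain, `(1 - |z|²)|f'(z)|` is at most
twice the distance from `f z` to the complement of the domain. -/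
theorem norm_deriv_mul_le_of_convex {Ω : Set ℂ} (ho : IsOpen Ω) (hc : Convex ℝ Ω) {f : ℂ → ℂ}
    (hf : DifferentiableOn ℂ f (ball 0 1)) (hm : MapsTo f (ball 0 1) Ω) {p z : ℂ} (hp : p ∉ Ω)
    (hz : z ∈ ball (0 : ℂ) 1) : ‖deriv f z‖ * (1 - ‖z‖ ^ 2) ≤ 2 * ‖p - f z‖ := by
  obtain ⟨n, hn, hlt⟩ := exists_unit_normal ho hc ⟨f z, hm hz⟩ hp
  have key := norm_deriv_mul_le_of_re_lt (hf.const_mul (conj n)) (fun x hx => hlt _ (hm hx)) hz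
  have hd := (hf.differentiableAt (isOpen_ball.mem_nhds hz)).hasDerivAt.const_mul (conj n)
  rw [hd.deriv, norm_mul, Complex.norm_conj, hn, one_mul, ← Complex.sub_re, ← mul_sub] at key
  refine key.trans ?_
  have := Complex.re_le_norm (conj n * (p - f z))
  rw [norm_mul, Complex.norm_conj, hn, one_mul] at this
  linarith

theorem norm_add_le_of_ball_subset {c : ℂ} {r R : ℝ} (hr : 0 < r) (h : ball c r ⊆ ball 0 R) :
    ‖c‖ + r ≤ R := by
  have hcl : closedBall c r ⊆ closedBall 0 R := by
    rw [← closure_ball c hr.ne']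
    exact closure_minimal (h.trans ball_subset_closedBall) isClosed_closedBall
  -- `c + r u` is a point of the closed disk farthest from `0`; for `c = 0` the value `arg 0 = 0`
  -- gives `u = 1`.
  set u := Complex.exp (c.arg * Complex.I)
  have hu : ‖u‖ = 1 := Complex.norm_exp_ofReal_mul_I _
  have hc : ‖c‖ * u = c := Complex.norm_mul_exp_arg_mul_I c
  have h1 := hcl (show c + r * u ∈ closedBall c r by
    rw [mem_closedBall_iff_norm, add_sub_cancel_left, norm_mul, hu, Complex.norm_real,
      Real.norm_of_nonneg hr.le, mul_one])
  have h2 : c + r * u = ((‖c‖ + r : ℝ) : ℂ) * u := by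
    conv_lhs => rw [← hc]
    push_cast
    ring
  rw [h2, mem_closedBall_zero_iff, norm_mul, hu, mul_one, Complex.norm_real,
    Real.norm_of_nonneg (by positivity)] at h1
  exact h1

/-! ### The distance bound `F` and the derivative estimate -/

/-- Centres of disks of radius `R_C` contained in `Ω` have hyperbolic distance at most
`radiiF R_O R_I R_C` to the origin. -/
theorem RadiiCondition.artanh_norm_le_radiiF {Ω : Set ℂ} {R_O R_I R_C : ℝ}
    (hΩ : RadiiCondition Ω R_O R_I R_C) {g : ℂ → ℂ} (hg : DifferentiableOn ℂ g Ω)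
    (hm : MapsTo g Ω (ball 0 1)) (hg0 : g 0 = 0) {c : ℂ} (hc : ball c R_C ⊆ Ω) :
    Real.artanh ‖g c‖ ≤ radiiF R_O R_I R_C := by
  have h0 : ‖c‖ ≤ R_O - R_C := by
    linarith [norm_add_le_of_ball_subset hΩ.curvature_pos (hc.trans hΩ.outer.1)]
  have hI : ball 0 R_I ⊆ Ω := hΩ.inner.1
  -- The segment starts at the centre of the larger disk: `c` in the first case, `0` in the second.
  rcases le_total R_I R_C with h | h
  · have key := abs_artanh_sub_le_of_balls hΩ.convex hg hm hΩ.inner_pos h hc hI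
      (d := R_O - R_C) (by simpa using h0)
    rw [hg0, norm_zero, Real.artanh_zero, zero_sub, abs_neg] at key
    simp only [radiiF, max_eq_left h, min_eq_right h]
    exact (le_abs_self _).trans key
  · have key := abs_artanh_sub_le_of_balls hΩ.convex hg hm hΩ.curvature_pos h hI hc
      (d := R_O - R_C) (by simpa using h0)
    rw [hg0, norm_zero, Real.artanh_zero, sub_zero] at key
    simp only [radiiF, max_eq_right h, min_eq_left h]
    exact (le_abs_self _).trans key

theorem norm_deriv_le_of_radiiF_lt_artanh {Ω : Set ℂ} {R_O R_I R_C : ℝ}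
    (hΩ : RadiiCondition Ω R_O R_I R_C) {f : ℂ → ℂ} (hf : IsConformalFromDiskOnto f Ω)
    (hf0 : f 0 = 0) {z : ℂ} (hz : z ∈ ball (0 : ℂ) 1)
    (hzF : radiiF R_O R_I R_C < Real.artanh ‖z‖) :
    ‖deriv f z‖ ≤ 4 * R_C * Real.exp (2 * radiiF R_O R_I R_C) / (1 + ‖z‖) ^ 2 := by
  obtain ⟨g, hg, hgf⟩ := exists_holomorphic_inverse isOpen_ball hf.holomorphic hf.injOn
  rw [hf.image_eq] at hg
  have hfm : MapsTo f (ball 0 1) Ω := fun x hx => hf.image_eq ▸ mem_image_of_mem f hx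
  have hm : MapsTo g Ω (ball 0 1) := fun w hw => by
    rw [← hf.image_eq] at hw
    obtain ⟨x, hx, rfl⟩ := hw
    rwa [hgf x hx]
  have hg0 : g 0 = 0 := by
    have := hgf 0 (mem_ball_self one_pos)
    rwa [hf0] at this
  have hcen := fun c => hΩ.artanh_norm_le_radiiF hg hm hg0 (c := c)
  have hC := hΩ.curvature_pos
  set F := radiiF R_O R_I R_C
  have hne : (Ωᶜ).Nonempty := by
    rw [nonempty_compl]
    intro h
    have := hΩ.outer.1 (h ▸ mem_univ (R_O : ℂ))
    rw [mem_ball_zero_iff, Complex.norm_real, Real.norm_of_nonneg hΩ.outer_pos.le] at this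
    exact lt_irrefl _ this
  have hcl : IsClosed Ωᶜ := hΩ.isOpen.isClosed_compl
  obtain ⟨p, hp, hpd⟩ := hcl.exists_infDist_eq_dist hne (f z)
  set δ := infDist (f z) Ωᶜ with hδ
  have hsub : ball (f z) δ ⊆ Ω := by
    have := ball_infDist_subset_compl (s := Ωᶜ) (x := f z)
    rwa [compl_compl] at this
  have hδ0 : 0 < δ := (hcl.notMem_iff_infDist_pos hne).1 fun h => h (hfm hz)
  have hpn : ‖p - f z‖ = δ := by
    rw [hpd, dist_eq_norm, norm_sub_rev]
  have hgz : g (f z) = z := hgf z hz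
  -- Otherwise `f z` would itself be the centre of an `R_C`-disk in `Ω`, forcing `artanh ‖z‖ ≤ F`.
  have hδC : δ < R_C := by
    by_contra! h
    have := hcen (f z) ((ball_subset_ball h).trans hsub)
    rw [hgz] at this
    linarith
  obtain ⟨A, hA⟩ := hΩ.union_disks
  obtain ⟨a, ha, hwa⟩ := exists_ball_subset_norm_sub_le hΩ.isOpen hΩ.convex hC hA hδ0 hδC.le hsub
    hp hpn
  have h1 := hcen a ha
  have h2 := (abs_le.1 (abs_artanh_sub_le_log hg hm (by linarith) (by linarith) ha hwa)).2
  have h3 := norm_deriv_mul_le_of_convex hΩ.isOpen hΩ.convex hf.holomorphic hfm hp hz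
  rw [hpn] at h3
  have hz1 : ‖z‖ < 1 := by simpa using hz
  have hz0 := norm_nonneg z
  set s := ‖z‖
  rw [hgz, Real.artanh_eq_half_log ⟨by linarith, hz1.le⟩, sub_sub_cancel] at h2
  have hs : 0 < 1 - s := by linarith
  have h4 : Real.log ((1 + s) / (1 - s)) ≤ 2 * F + Real.log ((R_C + (R_C - δ)) / δ) := by linarith
  have h5 : (1 + s) / (1 - s) ≤ Real.exp (2 * F) * ((R_C + (R_C - δ)) / δ) := by
    have := Real.exp_le_exp.2 h4
    rwa [Real.exp_log (by positivity), Real.exp_add,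
      Real.exp_log (div_pos (by linarith) hδ0)] at this
  have hE := Real.exp_pos (2 * F)
  rw [le_div_iff₀ (by positivity)]
  calc ‖deriv f z‖ * (1 + s) ^ 2 = ‖deriv f z‖ * (1 - s ^ 2) * ((1 + s) / (1 - s)) := by
        field_simp
        ring
    _ ≤ 2 * δ * (Real.exp (2 * F) * ((R_C + (R_C - δ)) / δ)) := by gcongr
    _ = 2 * (R_C + (R_C - δ)) * Real.exp (2 * F) := by field_simp
    _ ≤ 4 * R_C * Real.exp (2 * F) :=
        mul_le_mul_of_nonneg_right (by linarith) hE.le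

theorem mainTheorem1 (Ω : Set ℂ) (R_O R_I R_C : ℝ) (hΩ : RadiiCondition Ω R_O R_I R_C)
    (f : ℂ → ℂ) (hf : IsConformalFromDiskOnto f Ω) (hf0 : f 0 = 0) :
    hInftyNorm (deriv f) ≤ ENNReal.ofReal (R_C * Real.exp (2 * radiiF R_O R_I R_C)) := by
  refine iSup₂_le fun z₀ hz₀ => ?_
  rw [← ofReal_norm]
  refine ENNReal.ofReal_le_ofReal ?_
  have hz₀1 : ‖z₀‖ < 1 := by simpa using hz₀
  set F := radiiF R_O R_I R_C with hF
  have hlim : Tendsto (fun s : ℝ => 4 * R_C * Real.exp (2 * F) / (1 + s) ^ 2) (𝓝[<] 1)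
      (𝓝 (R_C * Real.exp (2 * F))) := by
    have hcont : ContinuousAt (fun s : ℝ => 4 * R_C * Real.exp (2 * F) / (1 + s) ^ 2) 1 :=
      continuousAt_const.div (by fun_prop) (by norm_num)
    convert hcont.tendsto.mono_left nhdsWithin_le_nhds using 2
    norm_num
    ring
  refine ge_of_tendsto hlim ?_
  filter_upwards [Ioo_mem_nhdsLT (max_lt hz₀1 (Real.tanh_lt_one F))] with s hs
  have hs0 : ‖z₀‖ < s := (le_max_left _ _).trans_lt hs.1
  have hsF : Real.tanh F < s := (le_max_right _ _).trans_lt hs.1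
  have hspos : 0 < s := (norm_nonneg _).trans_lt hs0
  have han : DifferentiableOn ℂ (deriv f) (ball 0 1) := hf.holomorphic.deriv isOpen_ball
  -- Maximum principle on `|z| ≤ s`: with `s > tanh F`, the boundary circle lies where the pointwise
  -- estimate holds.
  refine Complex.norm_le_of_forall_mem_frontier_norm_le (U := ball 0 s) isBounded_ball
    (DifferentiableOn.diffContOnCl ?_) (fun z hz => ?_)
    (subset_closure (by simpa using hs0))
  · rw [closure_ball _ hspos.ne']
    exact han.mono (closedBall_subset_ball hs.2)
  · rw [frontier_ball _ hspos.ne', mem_sphere_zero_iff_norm] at hz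
    rw [← hz]
    refine norm_deriv_le_of_radiiF_lt_artanh hΩ hf hf0 (by simpa [hz] using hs.2) ?_
    rw [hz, ← hF, ← Real.artanh_tanh F]
    exact Real.artanh_lt_artanh (Real.neg_one_lt_tanh _) hs.2 hsF
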